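/- Let $V$ be a complex vector space and let $\mathfrak{g}=(V,[\cdot,\cdot])$ and $\mathfrak{n}=(V,\{\cdot,\cdot\})$ be two complex Lie algebras with the same underlying vector space $V$. Suppose that $\mathfrak{g}$ is isomorphic to $\mathfrak{gl}_2(\mathbb{C})$ (so that $\dim V=4$) and that $\mathfrak{n}$ is nilpotent and non-abelian. Then there is no post-Lie algebra structure on the pair $(\mathfrak{g},\mathfrak{n})$; that is, there is no $\mathbb{C}$-bilinear product $V\times V\to V$, $(x,y)\mapsto x\cdot y$, satisfying \begin{align*} x\cdot y-y\cdot x&=[x,y]-\{x,y\},\\ [x,y]\cdot z&=x\cdot(y\cdot z)-y\cdot(x\cdot z),\\ x\cdot\{y,z\}&=\{x\cdot y,z\}+\{y,x\cdot z\} \end{align*} for all $x,y,z\in V$. -/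

import Mathlib

/-- A Lie bracket on a vector space `V` over a field `K`: a `K`-bilinear alternating product
satisfying the Jacobi identity. -/
structure LieBracketOn (K V : Type*) [Field K] [AddCommGroup V] [Module K V] where
  /-- The bracket, as a bilinear map. -/
  br : V →ₗ[K] V →ₗ[K] V
  br_self : ∀ x, br x x = 0
  jacobi : ∀ x y z, br x (br y z) + br y (br z x) + br z (br x y) = 0

namespace LieBracketOn

/-- The Lie algebra `(V, B)`: a copy of the vector space `V`, carrying the bracket `B`. -/
def Alg {K V : Type*} [Field K] [AddCommGroup V] [Module K V] (_B : LieBracketOn K V) :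
    Type _ := V

instance instAddCommGroup {K V : Type*} [Field K] [AddCommGroup V] [Module K V]
    (B : LieBracketOn K V) : AddCommGroup B.Alg := inferInstanceAs (AddCommGroup V)

instance instModule {K V : Type*} [Field K] [AddCommGroup V] [Module K V]
    (B : LieBracketOn K V) : Module K B.Alg := inferInstanceAs (Module K V)

theorem br_swap {K V : Type*} [Field K] [AddCommGroup V] [Module K V]
    (B : LieBracketOn K V) (x y : V) : B.br x y = -B.br y x := by
  have h := B.br_self (x + y)
  simp only [map_add, LinearMap.add_apply, B.br_self, zero_add, add_zero] at h
  exact eq_neg_of_add_eq_zero_right h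

theorem br_leibniz {K V : Type*} [Field K] [AddCommGroup V] [Module K V]
    (B : LieBracketOn K V) (x y z : V) :
    B.br x (B.br y z) = B.br (B.br x y) z + B.br y (B.br x z) := by
  have h := B.jacobi x y z
  rw [B.br_swap z x, B.br_swap z (B.br x y), map_neg] at h
  have h2 : B.br x (B.br y z) - (B.br (B.br x y) z + B.br y (B.br x z)) = 0 := by
    rw [← h]; abel
  exact sub_eq_zero.mp h2

instance instLieRing {K V : Type*} [Field K] [AddCommGroup V] [Module K V]
    (B : LieBracketOn K V) : LieRing B.Alg where
  bracket x y := B.br x y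
  add_lie x y z := LinearMap.map_add₂ B.br x y z
  lie_add x y z := map_add (B.br x) y z
  lie_self x := B.br_self x
  leibniz_lie x y z := B.br_leibniz x y z

instance instLieAlgebra {K V : Type*} [Field K] [AddCommGroup V] [Module K V]
    (B : LieBracketOn K V) : LieAlgebra K B.Alg where
  lie_smul t x y := map_smul (B.br x) t y

end LieBracketOn

/-- A post-Lie algebra structure (PA-structure) on the pair `(g, n)` of Lie brackets on the same
vector space `V`: a `K`-bilinear product `x · y` on `V` satisfying the three identities below,
where `[x, y] = g.br x y` and `{x, y} = n.br x y`. -/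
structure PostLieStructure {K V : Type*} [Field K] [AddCommGroup V] [Module K V]
    (g n : LieBracketOn K V) where
  /-- The product `x · y`, as a bilinear map. -/
  mul : V →ₗ[K] V →ₗ[K] V
  /-- `x · y - y · x = [x, y] - {x, y}` -/
  mul_sub_mul : ∀ x y, mul x y - mul y x = g.br x y - n.br x y
  /-- `[x, y] · z = x · (y · z) - y · (x · z)` -/
  br_mul : ∀ x y z, mul (g.br x y) z = mul x (mul y z) - mul y (mul x z)
  /-- `x · {y, z} = {x · y, z} + {y, x · z}` -/
  mul_br : ∀ x y z, mul x (n.br y z) = n.br (mul x y) z + n.br y (mul x z)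

-- The Lie algebra `gl_n(K)` is `Matrix (Fin n) (Fin n) K` with the bracket `A * B - B * A`.
attribute [local instance 100] LieRing.ofAssociativeRing

/-! Left multiplications by a standard triple `e`, `h`, `f` of sl₂ in `g` are derivations of `n`
satisfying the sl₂ relations. They cannot all vanish: otherwise {h, e} = [h, e] = 2e, against
nilpotency (`eq_zero_of_br_eq_smul`). On a space with an invariant flag of one-dimensional steps sl₂
acts trivially (`IsSl2Action.trivial_of_finrank_le`), so characteristic subspaces of `n` decide the
matter. The center Z has dimension 1 or 2.

In dimension 1, 0 < Z < Z₂ < C(Z₂) < V, with Z₂ the second center and C its centralizer, is such a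
flag. In dimension 2, the flag 0 < {V, V} < Z makes Z trivial. If V/Z is trivial too, so is V;
otherwise V/Z is the standard representation (`exists_highest_weight`), and the first post-Lie
identity, read in coordinates, makes `e`, `h`, `f` linearly dependent (`false_of_standard`). -/

/-! ### Nilpotency, center and derivations -/

/-- Otherwise no term of the lower central series could lie in `W`, not even the zero one. With `W`
the center it yields a noncentral element of the second center. -/
theorem LieAlgebra.exists_notMem_lie_mem {K L : Type*} [Field K] [LieRing L] [LieAlgebra K L]
    (hL : LieRing.IsNilpotent L) (W : Submodule K L) (hW : W ≠ ⊤) :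
    ∃ u, u ∉ W ∧ ∀ x : L, ⁅x, u⁆ ∈ W := by
  by_contra! hcon
  have key : ∀ k, ¬ ∀ v, v ∈ LieModule.lowerCentralSeries K L L k → v ∈ W := by
    intro k
    induction k with
    | zero => exact fun h => hW (Submodule.eq_top_iff'.mpr fun v => h v (LieSubmodule.mem_top v))
    | succ k ih =>
      refine fun h => ih fun v hv => ?_
      by_contra hvW
      obtain ⟨x, hx⟩ := hcon v hvW
      refine hx (h _ ?_)
      rw [LieModule.lowerCentralSeries_succ]
      exact LieSubmodule.lie_mem_lie (LieSubmodule.mem_top x) hv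
  obtain ⟨k, hk⟩ := (LieModule.isNilpotent_iff K L L).mp hL
  refine key k fun v hv => ?_
  rw [hk, LieSubmodule.mem_bot] at hv
  rw [hv]
  exact W.zero_mem

/-- A nilpotent ad x has no nonzero eigenvalue. -/
theorem LieAlgebra.eq_zero_of_lie_eq_smul {K L : Type*} [Field K] [LieRing L] [LieAlgebra K L]
    (hL : LieRing.IsNilpotent L) {x v : L} {t : K} (ht : t ≠ 0) (h : ⁅x, v⁆ = t • v) : v = 0 := by
  by_contra hv
  obtain ⟨k, hk⟩ := LieModule.exists_forall_pow_toEnd_eq_zero K L L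
  have hpow : ∀ k, (LieModule.toEnd K L L x ^ k) v = t ^ k • v := by
    intro k
    induction k with
    | zero => simp
    | succ k ih =>
      rw [pow_succ', Module.End.mul_apply, ih, map_smul, pow_succ, mul_smul]
      exact congrArg _ h
  have h0 := hpow k
  rw [hk x] at h0
  exact smul_ne_zero (pow_ne_zero k ht) hv h0.symm

namespace LieBracketOn

theorem exists_notMem_br_mem {K V : Type*} [Field K] [AddCommGroup V] [Module K V]
    (n : LieBracketOn K V) (hn : LieRing.IsNilpotent n.Alg) (W : Submodule K V) (hW : W ≠ ⊤) :
    ∃ u, u ∉ W ∧ ∀ x, n.br x u ∈ W :=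
  LieAlgebra.exists_notMem_lie_mem (K := K) hn W hW

theorem eq_zero_of_br_eq_smul {K V : Type*} [Field K] [AddCommGroup V] [Module K V]
    (n : LieBracketOn K V) (hn : LieRing.IsNilpotent n.Alg) {x v : V} {t : K} (ht : t ≠ 0)
    (h : n.br x v = t • v) : v = 0 :=
  LieAlgebra.eq_zero_of_lie_eq_smul (K := K) (L := n.Alg) hn ht h

/-- The center of the Lie algebra `(V, n)`. -/
def center {K V : Type*} [Field K] [AddCommGroup V] [Module K V] (n : LieBracketOn K V) :
    Submodule K V := LinearMap.ker n.br

theorem mem_center {K V : Type*} [Field K] [AddCommGroup V] [Module K V]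
    {n : LieBracketOn K V} {z : V} : z ∈ n.center ↔ ∀ x, n.br z x = 0 := by
  simp [center, LinearMap.ext_iff]

theorem br_eq_zero_of_mem_center {K V : Type*} [Field K] [AddCommGroup V] [Module K V]
    {n : LieBracketOn K V} {z : V} (hz : z ∈ n.center) (x : V) : n.br x z = 0 := by
  rw [n.br_swap, mem_center.mp hz x, neg_zero]

/-- `D` is a derivation of the Lie algebra `(V, n)`. -/
def IsDerivation {K V : Type*} [Field K] [AddCommGroup V] [Module K V] (n : LieBracketOn K V)
    (D : V →ₗ[K] V) : Prop :=
  ∀ y z, D (n.br y z) = n.br (D y) z + n.br y (D z)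

theorem IsDerivation.map_mem_center {K V : Type*} [Field K] [AddCommGroup V] [Module K V]
    {n : LieBracketOn K V} {D : V →ₗ[K] V} (hD : n.IsDerivation D) {z : V}
    (hz : z ∈ n.center) : D z ∈ n.center := by
  rw [mem_center] at hz ⊢
  intro x
  have := hD z x
  rw [hz, hz, map_zero, add_zero] at this
  exact this.symm

end LieBracketOn

/-! ### Trivial sl₂-actions -/

/-- Endomorphisms `E`, `H`, `F` of `V` satisfying the commutation relations of `sl₂`. -/
structure IsSl2Action {K V : Type*} [Field K] [AddCommGroup V] [Module K V]
    (E H F : V →ₗ[K] V) : Prop where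
  ef : ∀ v, E (F v) - F (E v) = H v
  he : ∀ v, H (E v) - E (H v) = (2 : K) • E v
  hf : ∀ v, H (F v) - F (H v) = -((2 : K) • F v)

namespace IsSl2Action

/-- `E`, `H` and `F` all vanish on `W`. -/
def Trivial {K V : Type*} [Field K] [AddCommGroup V] [Module K V]
    (E H F : V →ₗ[K] V) (W : Submodule K V) : Prop :=
  ∀ v ∈ W, E v = 0 ∧ H v = 0 ∧ F v = 0

/-- All products of two operators vanish on `W`, hence so do the commutators, and these recover `H`,
2`E` and -2`F`. -/
theorem trivial_of_map_mem {K V : Type*} [Field K] [CharZero K] [AddCommGroup V] [Module K V]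
    {E H F : V →ₗ[K] V} (hs : IsSl2Action E H F) {W W' : Submodule K V}
    (hE : ∀ v ∈ W, E v ∈ W') (hF : ∀ v ∈ W, F v ∈ W') (hT : Trivial E H F W') :
    Trivial E H F W := by
  intro v hv
  have hH : H v = 0 := by
    rw [← hs.ef, (hT _ (hF v hv)).1, (hT _ (hE v hv)).2.2, sub_zero]
  have h1 := hs.he v
  have h2 := hs.hf v
  rw [(hT _ (hE v hv)).2.1, hH, map_zero, sub_zero] at h1
  rw [(hT _ (hF v hv)).2.1, hH, map_zero, sub_zero] at h2
  refine ⟨?_, hH, ?_⟩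
  · simpa using h1.symm
  · simpa using h2.symm

/-- One-dimensional representations of sl₂ are trivial: modulo `W'`, `E` and `F` act on `w` by
scalars, so the commutator `H` kills it, and then so do `E` and `F`. Thus `W` is sent into `W'`. -/
theorem trivial_extend {K V : Type*} [Field K] [CharZero K] [AddCommGroup V] [Module K V]
    {E H F : V →ₗ[K] V} (hs : IsSl2Action E H F) {W W' : Submodule K V} (w : V)
    (hE : ∀ v ∈ W, E v ∈ W) (hF : ∀ v ∈ W, F v ∈ W) (hw : w ∈ W)
    (hWW' : ∀ v ∈ W, ∃ a : K, v - a • w ∈ W') (hT : Trivial E H F W') :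
    Trivial E H F W := by
  obtain ⟨a, ha⟩ := hWW' _ (hE w hw)
  obtain ⟨b, hb⟩ := hWW' _ (hF w hw)
  have hEw : ∃ p ∈ W', E w = a • w + p := ⟨_, ha, by abel⟩
  have hFw : ∃ p ∈ W', F w = b • w + p := ⟨_, hb, by abel⟩
  obtain ⟨p, hp, hEw⟩ := hEw
  obtain ⟨q, hq, hFw⟩ := hFw
  have hHw : H w = b • p - a • q := by
    rw [← hs.ef, hEw, hFw, map_add, map_add, map_smul, map_smul, (hT q hq).1, (hT p hp).2.2,
      hEw, hFw]
    module
  have hHm : H w ∈ W' := by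
    rw [hHw]; exact W'.sub_mem (W'.smul_mem _ hp) (W'.smul_mem _ hq)
  have hEm : E w ∈ W' := by
    have h := hs.he w
    rw [(hT _ hHm).1, hEw, map_add, map_smul, (hT p hp).2.1, ← hEw] at h
    rw [show E w = (2 : K)⁻¹ • (2 : K) • E w by simp, ← h]
    exact W'.smul_mem _ (W'.sub_mem (W'.add_mem (W'.smul_mem _ hHm) W'.zero_mem) W'.zero_mem)
  have hFm : F w ∈ W' := by
    have h := hs.hf w
    rw [(hT _ hHm).2.2, hFw, map_add, map_smul, (hT q hq).2.1, ← hFw] at h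
    rw [show F w = -(2 : K)⁻¹ • -((2 : K) • F w) by simp, ← h]
    exact W'.smul_mem _ (W'.sub_mem (W'.add_mem (W'.smul_mem _ hHm) W'.zero_mem) W'.zero_mem)
  refine hs.trivial_of_map_mem (W' := W') (fun v hv => ?_) (fun v hv => ?_) hT
  · obtain ⟨c, hc⟩ := hWW' v hv
    rw [show v = c • w + (v - c • w) by abel, map_add, map_smul, (hT _ hc).1, add_zero]
    exact W'.smul_mem _ hEm
  · obtain ⟨c, hc⟩ := hWW' v hv
    rw [show v = c • w + (v - c • w) by abel, map_add, map_smul, (hT _ hc).2.2, add_zero]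
    exact W'.smul_mem _ hFm

end IsSl2Action

/-! ### Center of codimension two -/

namespace LieBracketOn

section

variable {K V : Type*} [Field K] [AddCommGroup V] [Module K V]

/-- A derivation vanishing on the center acts on a two-dimensional `V / Z(n)` with trace zero, so
that its square is a scalar there. -/
theorem IsDerivation.exists_map_map_sub_smul_mem {n : LieBracketOn K V} {D : V →ₗ[K] V}
    (hD : n.IsDerivation D) (hZ : ∀ z ∈ n.center, D z = 0) {x u : V} (hxu : n.br x u ≠ 0)
    (hc : n.br x u ∈ n.center) (hspan : ∀ v, ∃ a b : K, v - (a • u + b • x) ∈ n.center) :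
    ∃ δ : K, ∀ v, D (D v) - δ • v ∈ n.center := by
  obtain ⟨a, b, h1⟩ := hspan (D u)
  obtain ⟨a', b', h2⟩ := hspan (D x)
  obtain ⟨z, hz, hu⟩ : ∃ z ∈ n.center, D u = a • u + b • x + z := ⟨_, h1, by abel⟩
  obtain ⟨z', hz', hx⟩ : ∃ z ∈ n.center, D x = a' • u + b' • x + z := ⟨_, h2, by abel⟩
  -- `D` kills the central element {x, u}, and also multiplies it by its trace on V/Z.
  have htr : b' = -a := by
    have h := hD x u
    rw [hZ _ hc, hu, hx] at h
    simp only [map_add, map_smul, LinearMap.add_apply, LinearMap.smul_apply, n.br_self,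
      mem_center.mp hz', br_eq_zero_of_mem_center hz, smul_zero, add_zero, zero_add] at h
    rw [← add_smul] at h
    rcases smul_eq_zero.mp h.symm with h | h
    · exact eq_neg_of_add_eq_zero_left h
    · exact absurd h hxu
  subst htr
  refine ⟨a * a + b * a', fun v => ?_⟩
  obtain ⟨p, q, h3⟩ := hspan v
  obtain ⟨w, hw, hv⟩ : ∃ z ∈ n.center, v = p • u + q • x + z := ⟨_, h3, by abel⟩
  have key : D (D v) - (a * a + b * a') • v =
      (p * a + q * a') • z + (p * b - q * a) • z' - (a * a + b * a') • w := by
    rw [hv]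
    simp only [map_add, map_smul, map_zero, hu, hx, hZ _ hz, hZ _ hz', hZ _ hw]
    module
  rw [key]
  exact sub_mem (add_mem (Submodule.smul_mem _ _ hz) (Submodule.smul_mem _ _ hz'))
    (Submodule.smul_mem _ _ hw)

/-- Modulo `Z`, `E`² is a scalar and so commutes with `H`; but [H, E²] = 2t E². -/
theorem map_map_mem_of_lie [CharZero K] {H E : V →ₗ[K] V} {Z : Submodule K V}
    (hH : ∀ z ∈ Z, H z = 0) {t δ : K} (ht : t ≠ 0) (hHE : ∀ v, H (E v) - E (H v) = t • E v)
    (hδ : ∀ v, E (E v) - δ • v ∈ Z) (v : V) : E (E v) ∈ Z := by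
  have h1 := hH _ (hδ v)
  rw [map_sub, map_smul, sub_eq_zero] at h1
  have h2 : H (E (E v)) - E (E (H v)) = (2 * t) • E (E v) := by
    have e1 := hHE (E v)
    have e2 := congrArg E (hHE v)
    rw [map_sub, map_smul] at e2
    linear_combination (norm := module) e1 + e2
  have h3 : E (E v) = -(2 * t)⁻¹ • (E (E (H v)) - δ • H v) := by
    rw [← h1, ← neg_sub, smul_neg, neg_smul, neg_neg, h2, smul_smul,
      inv_mul_cancel₀ (by simpa using ht), one_smul]
  rw [h3]
  exact Z.smul_mem _ (hδ _)

variable [CharZero K]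

/-- A nontrivial `sl₂`-action by derivations with trivial action on the center and two-dimensional
`V / Z(n)` is the standard representation modulo the center. -/
theorem exists_highest_weight {n : LieBracketOn K V} {E H F : V →ₗ[K] V}
    (hs : IsSl2Action E H F) (dE : n.IsDerivation E) (dF : n.IsDerivation F)
    (hT : IsSl2Action.Trivial E H F n.center) {x u : V} (hxu : n.br x u ≠ 0)
    (hc : n.br x u ∈ n.center) (hspan : ∀ v, ∃ a b : K, v - (a • u + b • x) ∈ n.center)
    {v₀ : V} (hv₀ : E v₀ ∉ n.center) :
    ∃ m, H m = m ∧ E m = 0 ∧ F (F m) = 0 ∧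
      ∀ a b : K, a • m + b • F m ∈ n.center → a = 0 ∧ b = 0 := by
  obtain ⟨δ, hδ⟩ := dE.exists_map_map_sub_smul_mem (fun z hz => (hT z hz).1) hxu hc hspan
  obtain ⟨ε, hε⟩ := dF.exists_map_map_sub_smul_mem (fun z hz => (hT z hz).2.2) hxu hc hspan
  have hEE := map_map_mem_of_lie (fun z hz => (hT z hz).2.1)
    (two_ne_zero (α := K)) hs.he hδ
  have hFF := map_map_mem_of_lie (fun z hz => (hT z hz).2.1)
    (neg_ne_zero.mpr (two_ne_zero (α := K))) (fun v => by rw [hs.hf, neg_smul]) hε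
  -- With E² = 0 modulo the center, HE + EH = E²F is central-valued, while HE - EH = 2E.
  have hHE : ∀ v, H (E v) - E v ∈ n.center := by
    intro v
    have e1 : H (E v) + E (H v) ∈ n.center := by
      have e2 := hs.ef (E v)
      have e3 := congrArg E (hs.ef v)
      rw [(hT _ (hEE v)).2.2, sub_zero] at e2
      rw [map_sub, e2] at e3
      rw [← e3, add_sub_cancel]
      exact hEE _
    have e4 : H (E v) - E v = (2 : K)⁻¹ • (H (E v) + E (H v)) := by
      have := hs.he v
      rw [eq_inv_smul_iff₀ two_ne_zero]
      linear_combination (norm := module) this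
    rw [e4]
    exact Submodule.smul_mem _ _ e1
  have hHm : H (H (E v₀)) = H (E v₀) := by
    have := (hT _ (hHE v₀)).2.1
    rwa [map_sub, sub_eq_zero] at this
  have hm : H (E v₀) ∉ n.center := by
    intro h
    exact hv₀ (by simpa using sub_mem h (hHE v₀))
  have hEm : E (H (E v₀)) ∈ n.center := by
    have := hs.he (E v₀)
    have e : E (H (E v₀)) = H (E (E v₀)) - (2 : K) • E (E v₀) := by rw [← this]; abel
    rw [e, (hT _ (hEE v₀)).2.1]
    exact sub_mem (zero_mem _) (Submodule.smul_mem _ _ (hEE v₀))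
  -- `E v₀` has weight 1 only modulo the center; applying `H` removes the central error.
  set m := H (E v₀)
  have hEm0 : E m = 0 := by
    have h := hs.he m
    rw [(hT _ hEm).2.1, hHm] at h
    have h3 : (3 : K) • E m = 0 := by linear_combination (norm := module) -h
    simpa using h3
  refine ⟨m, hHm, hEm0, ?_, fun a b hab => ?_⟩
  · have h1 := hs.hf m
    have h2 := hs.hf (F m)
    rw [hHm] at h1
    rw [(hT _ (hFF m)).2.1, sub_eq_iff_eq_add.mp h1, map_add, map_neg, map_smul] at h2
    have h3 : (3 : K) • F (F m) = 0 := by linear_combination (norm := module) h2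
    simpa using h3
  · have hEF := hs.ef m
    rw [hEm0, map_zero, sub_zero, hHm] at hEF
    have hb := (hT _ hab).1
    rw [map_add, map_smul, map_smul, hEm0, hEF, smul_zero, zero_add] at hb
    have hb0 : b = 0 := (smul_eq_zero.mp hb).resolve_right fun h0 => hm (h0 ▸ zero_mem _)
    subst hb0
    rw [zero_smul, add_zero] at hab
    refine ⟨?_, rfl⟩
    by_contra ha
    exact hm ((Submodule.smul_mem_iff _ ha).mp hab)

/-- The elements `e`, `h`, `f` of a 1-cocycle with values in the standard representation, twisted
by the bracket, are linearly dependent. -/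
theorem false_of_standard {n : LieBracketOn K V} {E H F : V →ₗ[K] V}
    (hs : IsSl2Action E H F) (hT : IsSl2Action.Trivial E H F n.center) {m : V}
    (hHm : H m = m) (hEm : E m = 0) (hFFm : F (F m) = 0)
    (hind : ∀ a b : K, a • m + b • F m ∈ n.center → a = 0 ∧ b = 0)
    (hc : n.br m (F m) ∈ n.center)
    (hspan : ∀ v, ∃ a b : K, v - (a • m + b • F m) ∈ n.center) {e h f : V}
    (hli : LinearIndependent K ![e, h, f])
    (hhe : H e - E h = (2 : K) • e - n.br h e) (hhf : H f - F h = -((2 : K) • f) - n.br h f)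
    (hef : E f - F e = h - n.br e f) : False := by
  have hEF : E (F m) = m := by
    have := hs.ef m
    rwa [hEm, map_zero, sub_zero, hHm] at this
  have hHF : H (F m) = -F m := by
    have := hs.hf m
    rw [hHm] at this
    linear_combination (norm := module) this
  -- From here on, equations are compared coordinatewise along `m`, `F m` and the center.
  have hind : ∀ a b : K, ∀ z ∈ n.center, a • m + b • F m + z = 0 → a = 0 ∧ b = 0 ∧ z = 0 := by
    intro a b z hz h
    obtain ⟨rfl, rfl⟩ := hind a b (by rw [eq_neg_of_add_eq_zero_left h]; exact neg_mem hz)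
    simpa using h
  have hdec : ∀ v, ∃ a b : K, ∃ z ∈ n.center, v = a • m + b • F m + z := fun v => by
    obtain ⟨a, b, h⟩ := hspan v
    exact ⟨a, b, _, h, by abel⟩
  have hbr : ∀ a b a' b' : K, ∀ z ∈ n.center, ∀ z' ∈ n.center,
      n.br (a • m + b • F m + z) (a' • m + b' • F m + z') =
        (a * b' - b * a') • n.br m (F m) := by
    intro a b a' b' z hz z' hz'
    simp only [map_add, map_smul, LinearMap.add_apply, LinearMap.smul_apply, n.br_self,
      mem_center.mp hz, br_eq_zero_of_mem_center hz', n.br_swap (F m) m]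
    module
  obtain ⟨e1, e2, ze, hze, rfl⟩ := hdec e
  obtain ⟨h1, h2, zh, hzh, rfl⟩ := hdec h
  obtain ⟨f1, f2, zf, hzf, rfl⟩ := hdec f
  rw [hbr _ _ _ _ _ hzh _ hze] at hhe
  rw [hbr _ _ _ _ _ hzh _ hzf] at hhf
  rw [hbr _ _ _ _ _ hze _ hzf] at hef
  simp only [map_add, map_smul, hHm, hEm, hEF, hHF, hFFm, hT _ hze, hT _ hzh, hT _ hzf, smul_zero,
    add_zero, zero_add] at hhe hhf hef
  set ω := n.br m (F m)
  obtain ⟨a1, a2, a3⟩ := hind (-e1 - h2) (-3 * e2) (-(2 : K) • ze + (h1 * e2 - h2 * e1) • ω)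
    (add_mem (Submodule.smul_mem _ _ hze) (Submodule.smul_mem _ _ hc))
    (by linear_combination (norm := module) hhe)
  obtain ⟨b1, b2, b3⟩ := hind (3 * f1) (f2 - h1) ((2 : K) • zf + (h1 * f2 - h2 * f1) • ω)
    (add_mem (Submodule.smul_mem _ _ hzf) (Submodule.smul_mem _ _ hc))
    (by linear_combination (norm := module) hhf)
  obtain ⟨c1, c2, c3⟩ := hind (f2 - h1) (-e1 - h2) (-zh + (e1 * f2 - e2 * f1) • ω)
    (add_mem (neg_mem hzh) (Submodule.smul_mem _ _ hc))
    (by linear_combination (norm := module) hef)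
  obtain rfl : e1 = -h2 := by linear_combination -a1
  obtain rfl : e2 = 0 := by simpa using a2
  obtain rfl : f1 = 0 := by simpa using b1
  obtain rfl : f2 = h1 := by linear_combination b2
  have hze' : ze = ((2 : K)⁻¹ * (f2 * 0 - h2 * -h2)) • ω := by
    rw [mul_smul, eq_inv_smul_iff₀ two_ne_zero]
    linear_combination (norm := module) -a3
  have hzf' : zf = ((2 : K)⁻¹ * -(f2 * f2 - h2 * 0)) • ω := by
    rw [mul_smul, eq_inv_smul_iff₀ two_ne_zero]
    linear_combination (norm := module) b3
  have hzh' : zh = (-h2 * f2 - 0 * 0) • ω := by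
    linear_combination (norm := module) -c3
  rw [Fintype.linearIndependent_iff] at hli
  -- All central parts are multiples of `ω`, so `e`, `h`, `f` lie in the span of `m`, `F m`, `ω`;
  -- these coefficients give a relation there. If it is the zero relation, then `e` = 0.
  have hdep := hli ![f2 * f2, f2 * h2, -(h2 * h2)] (by
    simp only [Fin.sum_univ_three, Matrix.cons_val]
    rw [hze', hzf', hzh']
    module)
  have hf2 : f2 = 0 := by simpa using hdep 0
  have hh2 : h2 = 0 := by simpa using hdep 2
  have := hli ![1, 0, 0] (by
    simp only [Fin.sum_univ_three, Matrix.cons_val]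
    rw [hze', hf2, hh2]
    simp) 0
  simp at this

end

end LieBracketOn

/-! ### Dimension counts -/

theorem Submodule.exists_sub_smul_mem {K V : Type*} [Field K] [AddCommGroup V] [Module K V]
    [FiniteDimensional K V] {W W' : Submodule K V} (hle : W' ≤ W)
    (hd : Module.finrank K W ≤ Module.finrank K W' + 1) :
    ∃ w ∈ W, ∀ v ∈ W, ∃ a : K, v - a • w ∈ W' := by
  by_cases h : W ≤ W'
  · exact ⟨0, W.zero_mem, fun v hv => ⟨0, by simpa using h hv⟩⟩
  obtain ⟨w, hw, hw'⟩ := SetLike.not_le_iff_exists.mp h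
  refine ⟨w, hw, fun v hv => ?_⟩
  have hlt : W' < W' ⊔ K ∙ w := by
    refine lt_of_le_of_ne le_sup_left fun h => hw' ?_
    rw [h]
    exact Submodule.mem_sup_right (Submodule.mem_span_singleton_self w)
  have heq : W' ⊔ K ∙ w = W := by
    refine Submodule.eq_of_le_of_finrank_le (sup_le hle (by simpa using hw)) ?_
    have := Submodule.finrank_lt_finrank_of_lt hlt
    omega
  rw [← heq] at hv
  obtain ⟨p, hp, q, hq, rfl⟩ := Submodule.mem_sup.mp hv
  obtain ⟨a, rfl⟩ := Submodule.mem_span_singleton.mp hq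
  exact ⟨a, by simpa using hp⟩

theorem IsSl2Action.trivial_of_finrank_le {K V : Type*} [Field K] [CharZero K] [AddCommGroup V]
    [Module K V] [FiniteDimensional K V] {E H F : V →ₗ[K] V} (hs : IsSl2Action E H F)
    {W W' : Submodule K V} (hE : ∀ v ∈ W, E v ∈ W) (hF : ∀ v ∈ W, F v ∈ W) (hle : W' ≤ W)
    (hd : Module.finrank K W ≤ Module.finrank K W' + 1) (hT : Trivial E H F W') :
    Trivial E H F W := by
  obtain ⟨w, hw, h⟩ := Submodule.exists_sub_smul_mem hle hd
  exact hs.trivial_extend w hE hF hw h hT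

theorem IsSl2Action.trivial_bot {K V : Type*} [Field K] [AddCommGroup V]
    [Module K V] (E H F : V →ₗ[K] V) : Trivial E H F (⊥ : Submodule K V) := by
  intro v hv
  simp [(Submodule.mem_bot K).mp hv]

theorem Submodule.finrank_sup_span_pair {K V : Type*} [Field K] [AddCommGroup V] [Module K V]
    [FiniteDimensional K V] {Z : Submodule K V} {p q : V}
    (hind : ∀ a b : K, a • p + b • q ∈ Z → a = 0 ∧ b = 0) :
    Module.finrank K ↥(Z ⊔ Submodule.span K {p, q}) = Module.finrank K Z + 2 := by
  have hli : LinearIndependent K ![p, q] := by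
    rw [LinearIndependent.pair_iff]
    intro a b h
    exact hind a b (h ▸ Z.zero_mem)
  have h2 : Module.finrank K (Submodule.span K {p, q}) = 2 := by
    rw [← Matrix.range_cons_cons_empty p q ![], finrank_span_eq_card hli, Fintype.card_fin]
  have hinf : Z ⊓ Submodule.span K {p, q} = ⊥ := by
    rw [Submodule.eq_bot_iff]
    rintro v ⟨hv, hv'⟩
    obtain ⟨a, b, rfl⟩ := Submodule.mem_span_pair.mp hv'
    obtain ⟨rfl, rfl⟩ := hind a b hv
    simp
  have := Submodule.finrank_sup_add_finrank_inf_eq Z (Submodule.span K {p, q})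
  rwa [hinf, finrank_bot, add_zero, h2] at this

theorem Submodule.mem_sup_span_pair {K V : Type*} [Field K] [AddCommGroup V] [Module K V]
    {Z : Submodule K V} {p q v : V} :
    v ∈ Z ⊔ Submodule.span K {p, q} ↔ ∃ a b : K, v - (a • p + b • q) ∈ Z := by
  constructor
  · intro h
    obtain ⟨z, hz, w, hw, rfl⟩ := Submodule.mem_sup.mp h
    obtain ⟨a, b, rfl⟩ := Submodule.mem_span_pair.mp hw
    exact ⟨a, b, by simpa using hz⟩
  · rintro ⟨a, b, h⟩
    rw [← sub_add_cancel v (a • p + b • q)]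
    exact add_mem (Submodule.mem_sup_left h)
      (Submodule.mem_sup_right (Submodule.mem_span_pair.mpr ⟨a, b, rfl⟩))

/-! ### Characteristic flags -/

namespace LieBracketOn

section

variable {K V : Type*} [Field K] [AddCommGroup V] [Module K V]

/-- The second term of the upper central series of `(V, n)`. -/
def secondCenter (n : LieBracketOn K V) : Submodule K V := ⨅ x, n.center.comap (n.br x)

theorem mem_secondCenter {n : LieBracketOn K V} {v : V} :
    v ∈ n.secondCenter ↔ ∀ x, n.br x v ∈ n.center := by
  simp [secondCenter]

theorem IsDerivation.map_mem_secondCenter {n : LieBracketOn K V} {D : V →ₗ[K] V}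
    (hD : n.IsDerivation D) {v : V} (hv : v ∈ n.secondCenter) : D v ∈ n.secondCenter := by
  rw [mem_secondCenter] at hv ⊢
  intro x
  rw [← add_sub_cancel_left (n.br (D x) v) (n.br x (D v)), ← hD]
  exact sub_mem (hD.map_mem_center (hv x)) (hv _)

theorem eq_zero_of_smul_add_smul_mem_center {n : LieBracketOn K V} {x u : V}
    (hxu : n.br x u ≠ 0) (a b : K) (h : a • u + b • x ∈ n.center) : a = 0 ∧ b = 0 := by
  have h1 := br_eq_zero_of_mem_center h x
  have h2 := mem_center.mp h u
  simp only [map_add, map_smul, LinearMap.add_apply, LinearMap.smul_apply, n.br_self, smul_zero,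
    add_zero, zero_add] at h1 h2
  exact ⟨(smul_eq_zero.mp h1).resolve_right hxu, (smul_eq_zero.mp h2).resolve_right hxu⟩

theorem br_mem_span_singleton {n : LieBracketOn K V} {x u : V}
    (hspan : ∀ v, ∃ a b : K, v - (a • u + b • x) ∈ n.center) (v w : V) :
    n.br v w ∈ K ∙ n.br x u := by
  obtain ⟨a, b, h⟩ := hspan v
  obtain ⟨a', b', h'⟩ := hspan w
  have e1 := mem_center.mp h w
  have e2 := br_eq_zero_of_mem_center h' (a • u + b • x)
  rw [map_sub, LinearMap.sub_apply, sub_eq_zero] at e1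
  rw [map_sub, sub_eq_zero] at e2
  rw [e1, e2, Submodule.mem_span_singleton]
  refine ⟨b * a' - a * b', ?_⟩
  simp only [map_add, map_smul, LinearMap.add_apply, LinearMap.smul_apply, n.br_self,
    n.br_swap u x]
  module

variable [FiniteDimensional K V]

/-- For a four-dimensional nilpotent Lie algebra with one-dimensional center, the second center is
two-dimensional. -/
theorem exists_sub_smul_mem_center {n : LieBracketOn K V} (h4 : Module.finrank K V = 4)
    (h1 : Module.finrank K n.center = 1) {x u : V} (hxu : n.br x u ≠ 0)
    (hu : u ∈ n.secondCenter) {v : V} (hv : v ∈ n.secondCenter) :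
    ∃ a : K, v - a • u ∈ n.center := by
  have hcen : ∀ z ∈ n.center, ∃ t : K, z = t • n.br x u := by
    intro z hz
    obtain ⟨t, ht⟩ := (finrank_eq_one_iff_of_nonzero' (⟨n.br x u, mem_secondCenter.mp hu x⟩ :
      n.center) (by simpa [Subtype.ext_iff] using hxu)).mp h1 ⟨z, hz⟩
    exact ⟨t, (congrArg Subtype.val ht).symm⟩
  have hM := Submodule.finrank_sup_span_pair (eq_zero_of_smul_add_smul_mem_center hxu)
  obtain ⟨y₀, -, hy₀⟩ := Submodule.exists_sub_smul_mem (W := ⊤)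
    (W' := n.center ⊔ Submodule.span K {u, x}) le_top (by rw [finrank_top, hM, h4, h1])
  have hy₀M : y₀ ∉ n.center ⊔ Submodule.span K {u, x} := by
    intro h
    have : n.center ⊔ Submodule.span K {u, x} = ⊤ := by
      rw [Submodule.eq_top_iff']
      intro v
      obtain ⟨a, ha⟩ := hy₀ v trivial
      simpa using add_mem ha (Submodule.smul_mem _ a h)
    rw [this, finrank_top, h4, h1] at hM
    omega
  obtain ⟨s, hs⟩ := hcen _ (mem_secondCenter.mp hu y₀)
  obtain ⟨y, hyu, hy, hyM⟩ : ∃ y, n.br y u = 0 ∧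
      (∀ v, ∃ a b c : K, v - (a • u + b • x + c • y) ∈ n.center) ∧
      ∀ a : K, y - a • u ∉ n.center := by
    -- Since {y₀, u} = s{x, u}, subtracting s x makes the complement commute with `u`.
    refine ⟨y₀ - s • x, ?_, fun v => ?_, fun a ha => hy₀M ?_⟩
    · rw [map_sub, LinearMap.sub_apply, map_smul, LinearMap.smul_apply, hs, sub_self]
    · obtain ⟨c, hc⟩ := hy₀ v trivial
      obtain ⟨a, b, hab⟩ := Submodule.mem_sup_span_pair.mp hc
      refine ⟨a, b + c * s, c, ?_⟩
      convert hab using 1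
      module
    · rw [Submodule.mem_sup_span_pair]
      refine ⟨a, s, ?_⟩
      convert ha using 1
      module
  have hxy : n.br x y ∉ n.center := by
    intro h
    obtain ⟨t, ht⟩ := hcen _ h
    -- If {x, y} = t{x, u}, then y - t u commutes with `u`, `x` and `y`, hence is central.
    refine hyM t (mem_center.mpr fun v => ?_)
    obtain ⟨a, b, c, hv⟩ := hy v
    have e1 := br_eq_zero_of_mem_center hv (y - t • u)
    rw [map_sub, sub_eq_zero] at e1
    rw [e1]
    simp only [map_add, map_sub, map_smul, LinearMap.sub_apply, LinearMap.smul_apply, hyu,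
      n.br_self, n.br_swap y x, ht, n.br_swap u x, n.br_swap u y, smul_zero, sub_zero, neg_zero]
    module
  obtain ⟨a, b, c, h⟩ := hy v
  obtain ⟨z, hz, hvz⟩ : ∃ z ∈ n.center, v = a • u + b • x + c • y + z := ⟨_, h, by abel⟩
  have ex := mem_secondCenter.mp hv x
  have ey := mem_secondCenter.mp hv y
  have hu' := mem_secondCenter.mp hu
  rw [hvz] at ex ey
  simp only [map_add, map_smul, n.br_self, smul_zero, br_eq_zero_of_mem_center hz, hyu, zero_add,
    add_zero] at ex ey
  have hc : c = 0 := by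
    by_contra hc
    rw [Submodule.add_mem_iff_right _ (Submodule.smul_mem _ _ (hu' x)),
      Submodule.smul_mem_iff _ hc] at ex
    exact hxy ex
  have hb : b = 0 := by
    by_contra hb
    rw [Submodule.smul_mem_iff _ hb, n.br_swap, neg_mem_iff] at ey
    exact hxy ey
  refine ⟨a, ?_⟩
  rw [hvz, hb, hc]
  simpa using hz

variable [CharZero K]

theorem trivial_top_of_finrank_center_eq_one {n : LieBracketOn K V} (h4 : Module.finrank K V = 4)
    (h1 : Module.finrank K n.center = 1) {x u : V} (hxu : n.br x u ≠ 0)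
    (hu : u ∈ n.secondCenter) {E H F : V →ₗ[K] V} (hs : IsSl2Action E H F)
    (dE : n.IsDerivation E) (dF : n.IsDerivation F) : IsSl2Action.Trivial E H F ⊤ := by
  have t1 : IsSl2Action.Trivial E H F n.center :=
    hs.trivial_of_finrank_le (fun _ => dE.map_mem_center) (fun _ => dF.map_mem_center) bot_le
      (by rw [h1, finrank_bot]) (IsSl2Action.trivial_bot E H F)
  have hZ : ∀ v ∈ n.secondCenter, ∃ a : K, v - a • u ∈ n.center :=
    fun v hv => exists_sub_smul_mem_center h4 h1 hxu hu hv
  have t2 : IsSl2Action.Trivial E H F n.secondCenter :=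
    hs.trivial_extend u (fun _ => dE.map_mem_secondCenter) (fun _ => dF.map_mem_secondCenter) hu
      hZ t1
  have huc : u ∉ n.center := fun h => hxu (br_eq_zero_of_mem_center h x)
  have hlt : n.center < n.secondCenter := by
    refine lt_of_le_of_ne (fun z hz => mem_secondCenter.mpr fun x => ?_) fun h => huc (h ▸ hu)
    rw [br_eq_zero_of_mem_center hz]
    exact zero_mem _
  have hd2 := Submodule.finrank_lt_finrank_of_lt hlt
  have hbr : ∀ v ∈ n.secondCenter, n.br u v = 0 := by
    intro v hv
    obtain ⟨a, ha⟩ := hZ v hv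
    have := br_eq_zero_of_mem_center ha u
    rwa [map_sub, map_smul, n.br_self, smul_zero, sub_zero] at this
  -- The kernel of ad u is the centralizer of the second center, hence stable under derivations; its
  -- codimension is 1 because ad u has rank one.
  have hX : ∀ D : V →ₗ[K] V, n.IsDerivation D → ∀ v ∈ LinearMap.ker (n.br u),
      D v ∈ LinearMap.ker (n.br u) := by
    intro D hD v hv
    rw [LinearMap.mem_ker] at hv ⊢
    have := hD u v
    rw [hv, map_zero, n.br_swap (D u) v] at this
    have h2 : n.br v (D u) = 0 := by
      obtain ⟨a, ha⟩ := hZ _ (hD.map_mem_secondCenter hu)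
      have h3 := br_eq_zero_of_mem_center ha v
      rwa [map_sub, map_smul, n.br_swap v u, hv, neg_zero, smul_zero, sub_zero] at h3
    rw [h2, neg_zero, zero_add] at this
    exact this.symm
  have hrk := (n.br u).finrank_range_add_finrank_ker
  have hrange : LinearMap.range (n.br u) ≤ n.center := by
    rintro _ ⟨v, rfl⟩
    rw [n.br_swap]
    exact neg_mem (mem_secondCenter.mp hu v)
  have hr1 := Submodule.finrank_mono hrange
  have hr0 : Module.finrank K (LinearMap.range (n.br u)) ≠ 0 := by
    intro h
    rw [Submodule.finrank_eq_zero, LinearMap.range_eq_bot] at h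
    apply hxu
    rw [n.br_swap, h, LinearMap.zero_apply, neg_zero]
  have t3 : IsSl2Action.Trivial E H F (LinearMap.ker (n.br u)) :=
    hs.trivial_of_finrank_le (hX E dE) (hX F dF) (fun v hv => hbr v hv) (by omega) t2
  exact hs.trivial_of_finrank_le (fun _ _ => trivial) (fun _ _ => trivial) le_top
    (by rw [finrank_top]; omega) t3

theorem trivial_center_of_finrank_center_eq_two {n : LieBracketOn K V}
    (h2 : Module.finrank K n.center = 2) {x u : V} (hxu : n.br x u ≠ 0)
    (hc : n.br x u ∈ n.center) (hspan : ∀ v, ∃ a b : K, v - (a • u + b • x) ∈ n.center)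
    {E H F : V →ₗ[K] V} (hs : IsSl2Action E H F)
    (dE : n.IsDerivation E) (dF : n.IsDerivation F) :
    IsSl2Action.Trivial E H F n.center := by
  have hD : ∀ D : V →ₗ[K] V, n.IsDerivation D → ∀ v ∈ K ∙ n.br x u, D v ∈ K ∙ n.br x u := by
    intro D hD v hv
    obtain ⟨a, rfl⟩ := Submodule.mem_span_singleton.mp hv
    rw [map_smul, hD]
    exact Submodule.smul_mem _ _ (add_mem (br_mem_span_singleton hspan _ _)
      (br_mem_span_singleton hspan _ _))
  have hd : Module.finrank K (K ∙ n.br x u) = 1 := finrank_span_singleton hxu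
  have t1 : IsSl2Action.Trivial E H F (K ∙ n.br x u) :=
    hs.trivial_of_finrank_le (hD E dE) (hD F dF) bot_le (by rw [hd, finrank_bot])
      (IsSl2Action.trivial_bot E H F)
  exact hs.trivial_of_finrank_le (fun _ => dE.map_mem_center) (fun _ => dF.map_mem_center)
    (by simpa using hc) (by omega) t1

end

end LieBracketOn

/-! ### The contradiction -/

theorem PostLieStructure.false_of_sl2_triple {K V : Type*} [Field K] [CharZero K] [AddCommGroup V]
    [Module K V] [FiniteDimensional K V] {g n : LieBracketOn K V} (P : PostLieStructure g n)
    (h4 : Module.finrank K V = 4) (hn : LieRing.IsNilpotent n.Alg) (hna : n.center ≠ ⊤)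
    {e h f : V} (hli : LinearIndependent K ![e, h, f]) (hef : g.br e f = h)
    (hhe : g.br h e = (2 : K) • e) (hhf : g.br h f = -((2 : K) • f)) : False := by
  have hs : IsSl2Action (P.mul e) (P.mul h) (P.mul f) := by
    refine ⟨fun v => ?_, fun v => ?_, fun v => ?_⟩
    · rw [← P.br_mul, hef]
    · rw [← P.br_mul, hhe, map_smul, LinearMap.smul_apply]
    · rw [← P.br_mul, hhf, map_neg, map_smul, LinearMap.neg_apply, LinearMap.smul_apply]
  have dE : n.IsDerivation (P.mul e) := P.mul_br e
  have dF : n.IsDerivation (P.mul f) := P.mul_br f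
  have hnt : ¬ IsSl2Action.Trivial (P.mul e) (P.mul h) (P.mul f) ⊤ := by
    intro hT
    have h1 := P.mul_sub_mul h e
    rw [(hT e trivial).2.1, (hT h trivial).1, sub_zero, hhe] at h1
    exact hli.ne_zero 0 (n.eq_zero_of_br_eq_smul hn two_ne_zero (sub_eq_zero.mp h1.symm).symm)
  obtain ⟨u, huZ, hu⟩ := n.exists_notMem_br_mem hn _ hna
  obtain ⟨x, hxu⟩ : ∃ x, n.br x u ≠ 0 := by
    by_contra! hcon
    exact huZ (LieBracketOn.mem_center.mpr fun x => by rw [n.br_swap, hcon, neg_zero])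
  have hdim := Submodule.finrank_sup_span_pair
    (LieBracketOn.eq_zero_of_smul_add_smul_mem_center hxu)
  have hle := Submodule.finrank_le (n.center ⊔ Submodule.span K {u, x})
  have hpos : Module.finrank K n.center ≠ 0 := by
    intro h0
    rw [Submodule.finrank_eq_zero] at h0
    exact hxu (by simpa [h0] using hu x)
  obtain h1 | h2 : Module.finrank K n.center = 1 ∨ Module.finrank K n.center = 2 := by omega
  · exact hnt (LieBracketOn.trivial_top_of_finrank_center_eq_one h4 h1 hxu
      (LieBracketOn.mem_secondCenter.mpr hu) hs dE dF)
  have hspan : ∀ p q : V, (∀ a b : K, a • p + b • q ∈ n.center → a = 0 ∧ b = 0) →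
      ∀ v, ∃ a b : K, v - (a • p + b • q) ∈ n.center := by
    intro p q hpq v
    rw [← Submodule.mem_sup_span_pair, Submodule.eq_top_of_finrank_eq (S := n.center ⊔ _)
      (by rw [Submodule.finrank_sup_span_pair hpq, h2, h4])]
    trivial
  have hspan' := hspan u x (LieBracketOn.eq_zero_of_smul_add_smul_mem_center hxu)
  have hT := LieBracketOn.trivial_center_of_finrank_center_eq_two h2 hxu (hu x) hspan' hs dE dF
  -- If `E` maps into the center, so does H = EF - FE, as `F` kills the center; then so does `F`,
  -- through 2F = FH - HF.
  by_cases hE : ∀ v, P.mul e v ∈ n.center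
  · refine hnt (hs.trivial_of_map_mem (W' := n.center) (fun v _ => hE v) (fun v _ => ?_) hT)
    have hH : P.mul h v ∈ n.center := by
      rw [← hs.ef, (hT _ (hE v)).2.2, sub_zero]
      exact hE _
    have hH' : P.mul h (P.mul f v) ∈ n.center := by
      rw [← hs.ef, (hT _ (hE _)).2.2, sub_zero]
      exact hE _
    have := hs.hf v
    rw [(hT _ hH).2.2, sub_zero] at this
    rw [this, neg_mem_iff, Submodule.smul_mem_iff _ two_ne_zero] at hH'
    exact hH'
  · push Not at hE
    obtain ⟨v₀, hv₀⟩ := hE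
    obtain ⟨m, hHm, hEm, hFFm, hind⟩ :=
      LieBracketOn.exists_highest_weight hs dE dF hT hxu (hu x) hspan' hv₀
    have hsm := hspan _ _ hind
    refine LieBracketOn.false_of_standard hs hT hHm hEm hFFm hind
      (Submodule.span_singleton_le_iff_mem _ _ |>.mpr (hu x)
        (LieBracketOn.br_mem_span_singleton hspan' _ _)) hsm hli ?_ ?_ ?_
    · rw [P.mul_sub_mul, hhe]
    · rw [P.mul_sub_mul, hhf]
    · rw [P.mul_sub_mul, hef]

theorem proposition5p3 {V : Type*} [AddCommGroup V] [Module ℂ V] (g n : LieBracketOn ℂ V)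
    (hg : Nonempty (g.Alg ≃ₗ⁅ℂ⁆ Matrix (Fin 2) (Fin 2) ℂ))
    (hn : LieRing.IsNilpotent n.Alg) (hna : ¬ IsLieAbelian n.Alg) :
    IsEmpty (PostLieStructure g n) := by
  obtain ⟨φ⟩ := hg
  refine ⟨fun P => ?_⟩
  let ψ : V ≃ₗ[ℂ] Matrix (Fin 2) (Fin 2) ℂ := φ.toLinearEquiv
  have hψ : ∀ x y, ψ (g.br x y) = ψ x * ψ y - ψ y * ψ x := fun x y => φ.map_lie x y
  have : FiniteDimensional ℂ V := ψ.symm.finiteDimensional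
  have h4 : Module.finrank ℂ V = 4 := by
    rw [ψ.finrank_eq, Module.finrank_matrix]
    simp
  have hna' : n.center ≠ ⊤ := by
    intro h
    refine hna ⟨fun x y => ?_⟩
    have hx : (show V from x) ∈ n.center := by rw [h]; trivial
    exact LieBracketOn.mem_center.mp hx y
  refine P.false_of_sl2_triple h4 hn hna' (e := ψ.symm !![0, 1; 0, 0])
    (h := ψ.symm !![1, 0; 0, -1]) (f := ψ.symm !![0, 0; 1, 0]) ?_ ?_ ?_ ?_
  · rw [Fintype.linearIndependent_iff]
    intro c hc
    have := congrArg ψ hc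
    simp only [Fin.sum_univ_three, Matrix.cons_val, map_add, map_smul, map_zero,
      LinearEquiv.apply_symm_apply] at this
    have h00 := congrFun (congrFun this 0) 0
    have h01 := congrFun (congrFun this 0) 1
    have h10 := congrFun (congrFun this 1) 0
    simp at h00 h01 h10
    intro i
    fin_cases i <;> simp [h00, h01, h10]
  all_goals
    apply ψ.injective
    rw [hψ]
    simp only [map_smul, map_neg, LinearEquiv.apply_symm_apply]
    ext i j
    fin_cases i <;> fin_cases j <;> simp <;> norm_num
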